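/- **Theorem (strong law for degrees in random $m$-ary hooking networks).** Let $G_0$ be a finite connected graph (the seed; loops, counted twice in degrees, and parallel edges are allowed) with $\tau_0\ge 2$ vertices, one of which is designated as the hook. Let $d_1<\dots<d_k$ be the distinct vertex degrees of $G_0$, let $n_j$ be the number of vertices of degree $d_j$ in $G_0$, and let $h=d_i$ be the degree of the hook. Fix an integer $m\ge 1$. The $m$-ary hooking network grows as follows. The network of age $0$ is $G_0$. Every vertex enters the network with $m$ insertion positions. At each step $n\ge1$ one of the unused insertion positions of the network of age $n-1$ is chosen uniformly at random, given the past, and is used up; the vertex it belongs to (the latch) is fused with the hook of a new copy of $G_0$. The vertices of this copy other than its hook are new, and each brings $m$ insertion positions. Let $D_{n,d_j+sh}$ be the number of vertices of the network of age $n$ whose original degree (their degree in the copy of $G_0$ with which they came) is $d_j$ and that have been a latch exactly $s$ times; these counts are indexed by the pairs $(j,s)$, $1\le j\le k$, $0\le s\le m$, even if some of the numbers $d_j+sh$ coincide. Let $\mathbf D_n=(\mathbf D_n^{(0)},\dots,\mathbf D_n^{(m)})$ with blocks $\mathbf D_n^{(s)}=(D_{n,d_1+sh},\dots,D_{n,d_k+sh})^T$.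 Let $\mathbf A$ be the $mk\times mk$ replacement matrix of the urn of insertion positions, where a position has colour $(s,j)$, $0\le s\le m-1$, $1\le j\le k$, if its vertex has original degree $d_j$ and has been a latch $s$ times: the entry of $\mathbf A$ in row $(s,j)$ and column $(s',j')$ is $$m(n_{j'}-\mathbf 1[j'=i])\,\mathbf 1[s'=0]-(m-s)\,\mathbf 1[s'=s,\,j'=j]+(m-s-1)\,\mathbf 1[s'=s+1,\,j'=j].$$ Suppose that the network is invertible, that is, that $\mathbf A^T$ is invertible. Write $(x)_r=x(x-1)\cdots(x-r+1)$, $\alpha_m=m\tau_0-m-1$ and $$\mathbf y_1=\frac{m}{m\tau_0-1}\,(n_1,\dots,n_{i-1},\,n_i-1,\,n_{i+1},\dots,n_k)^T .$$ Then $\frac1n\mathbf D_n$ converges almost surely, as $n\to\infty$, to the vector with blocks $$\frac{\alpha_m}{m-s}\,\frac{(m-1)_s}{(m\tau_0-2)_s}\,\mathbf y_1\quad(s=0,\dots,m-1),\qquad \frac{(m-1)_{m-1}}{(m\tau_0-2)_{m-1}}\,\mathbf y_1\quad(s=m).$$ -/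

import Mathlib

open MeasureTheory Filter Topology

namespace HookingNetwork

noncomputable section

/-- The degree of a vertex in a multigraph; a loop contributes two. -/
def deg {α β : Type*} (G : Graph α β) (v : α) : ℕ :=
  (G.incidenceSet v).ncard + (G.loopSet v).ncard

/-- A seed: a finite connected multigraph (parallel edges and loops are allowed)
with a distinguished vertex, the hook. -/
structure IsSeed {α β : Type*} (G : Graph α β) (hook : α) : Prop where
  finite_vertexSet : G.vertexSet.Finite
  finite_edgeSet : G.edgeSet.Finite
  hook_mem : hook ∈ G.vertexSet
  connected : ∀ u ∈ G.vertexSet, ∀ v ∈ G.vertexSet, Relation.ReflTransGen G.Adj u v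

/-- Where the vertex `v` of the `t`-th copy of the seed sits in the network. Copy `0` is the
initial network. Copy `t + 1` is adjoined at step `t + 1`: its hook is identified with the
vertex `latch t` of the existing network, its other vertices are new. -/
def place {α : Type*} (hook : α) (latch : ℕ → ℕ × α) : ℕ → α → ℕ × α
  | 0, v => (0, v)
  | t + 1, v => open Classical in if v = hook then latch t else (t + 1, v)

/-- The network of age `n`: the union of the copies `0, …, n` of the seed, with the hook of
copy `t + 1` fused into `latch t`. The vertex `(t, v)` is the vertex `v` that entered the network
with copy `t`, and `(t, e)` is the edge `e` of copy `t`. -/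
def network {α β : Type*} (G : Graph α β) (hook : α) (latch : ℕ → ℕ × α) (n : ℕ) :
    Graph (ℕ × α) (ℕ × β) where
  vertexSet := {y | ∃ t ≤ n, ∃ v ∈ G.vertexSet, place hook latch t v = y}
  IsLink e y z := e.1 ≤ n ∧ ∃ v w, G.IsLink e.2 v w ∧
    place hook latch e.1 v = y ∧ place hook latch e.1 w = z
  isLink_symm := by
    intro e _
    refine ⟨?_⟩
    rintro y z ⟨hn, v, w, h, hv, hw⟩
    exact ⟨hn, w, v, h.symm, hw, hv⟩
  eq_or_eq_of_isLink_of_isLink := by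
    rintro e x y v w ⟨-, a, b, h, rfl, rfl⟩ ⟨-, c, d, h', rfl, rfl⟩
    rcases h.left_eq_or_eq h' with rfl | rfl
    · exact Or.inl rfl
    · exact Or.inr rfl
  left_mem_of_isLink := by
    rintro e x y ⟨hn, a, b, h, rfl, rfl⟩
    exact ⟨e.1, hn, a, h.left_mem, rfl⟩

/-- An insertion position: a vertex of the network, and one of the `m` slots (virtual nodes)
that this vertex had when it entered the network. -/
abbrev Position (α : Type*) (m : ℕ) : Type _ := (ℕ × α) × Fin m

/-- The latches belonging to a sequence of chosen insertion positions. -/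
def latches {α : Type*} {m : ℕ} (q : ℕ → Position α m) : ℕ → ℕ × α := fun t => (q t).1

/-- The insertion positions available in the network of age `n`, when `q t` is the position used
at step `t + 1`: all slots at vertices of the network that have not been used. A vertex that has
recruited `r` times has `m - r` of them. -/
def available {α β : Type*} (G : Graph α β) (hook : α) {m : ℕ} (q : ℕ → Position α m) (n : ℕ) :
    Set (Position α m) :=
  {p | p.1 ∈ (network G hook (latches q) n).vertexSet ∧ ∀ t < n, q t ≠ p}

/-- The random growth of the `m`-ary hooking network: `p t` is the insertion position chosen at
step `t + 1`; given the history, it is uniformly distributed over the available positions. -/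
structure IsUniformGrowth {α β Ω : Type*} [MeasurableSpace Ω] (G : Graph α β) (hook : α)
    (m : ℕ) (μ : Measure Ω) (p : ℕ → Ω → Position α m) : Prop where
  measurableSet_eq : ∀ t q, MeasurableSet {ω | p t ω = q}
  mem_available : ∀ᵐ ω ∂μ, ∀ n, p n ω ∈ available G hook (fun t => p t ω) n
  uniform : ∀ (n : ℕ) (q : ℕ → Position α m), q n ∈ available G hook q n →
    μ {ω | ∀ t ≤ n, p t ω = q t} =
      μ {ω | ∀ t < n, p t ω = q t} / ((available G hook q n).ncard : ENNReal)

/-- The number of times the vertex `y` has been the latch in the first `n` steps. -/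
def timesLatched {α : Type*} (latch : ℕ → ℕ × α) (n : ℕ) (y : ℕ × α) : ℕ :=
  {t | t < n ∧ latch t = y}.ncard

/-- The number of vertices of the network of age `n` that have latched `s` times and whose
original degree, that is, their degree in the copy of the seed with which they came, is `d`. -/
def degreeCount {α β : Type*} (G : Graph α β) (hook : α) (latch : ℕ → ℕ × α)
    (n d s : ℕ) : ℕ :=
  {y ∈ (network G hook latch n).vertexSet |
    deg G y.2 = d ∧ timesLatched latch n y = s}.ncard

/-- The number of vertices of degree `d` in the seed. -/
def seedCount {α β : Type*} (G : Graph α β) (d : ℕ) : ℕ :=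
  {v ∈ G.vertexSet | deg G v = d}.ncard

/-- The replacement matrix of the urn of insertion positions. The colour `(s, j)` is carried by
the insertion positions at vertices of original degree `d j` that have latched `s` times, `c j` is
the number of vertices of degree `d j` in the seed, and `i` is the index of the degree of the hook.
Row `(s, j)` lists the changes when a position of colour `(s, j)` is chosen: the new copy of the
seed brings `m * c l` positions of each colour `(0, l)`, except that those of its hook are lost;
the `m - s` positions at the latch disappear and `m - s - 1` of colour `(s + 1, j)` appear. -/
def replacementMatrix (m k : ℕ) (c : Fin k → ℕ) (i : Fin k) :
    Matrix (Fin m × Fin k) (Fin m × Fin k) ℝ :=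
  Matrix.of fun a b =>
    (if (b.1 : ℕ) = 0 then (m : ℝ) * ((c b.2 : ℝ) - if b.2 = i then 1 else 0) else 0)
    - (if b = a then (m : ℝ) - (a.1 : ℝ) else 0)
    + (if (b.1 : ℕ) = a.1 + 1 ∧ b.2 = a.2 then (m : ℝ) - (a.1 : ℝ) - 1 else 0)

/-- The falling factorial `x (x - 1) ⋯ (x - r + 1)`. -/
def fallingFactorial (x : ℝ) (r : ℕ) : ℝ := ∏ l ∈ Finset.range r, (x - (l : ℝ))

/-- The vector `y₁ = m / (m τ₀ - 1) * (c 1, …, c i - 1, …, c k)`. -/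
def firstBlock (m τ₀ k : ℕ) (c : Fin k → ℕ) (i : Fin k) (j : Fin k) : ℝ :=
  (m : ℝ) / ((m : ℝ) * (τ₀ : ℝ) - 1) * ((c j : ℝ) - if j = i then 1 else 0)

/-- The limit of the scaled degree vector. Its block `s < m` is
`α_m / (m - s) * (m - 1)_s / (m τ₀ - 2)_s * y₁` with `α_m = m τ₀ - m - 1`, and its block `s = m` is
`(m - 1)_(m - 1) / (m τ₀ - 2)_(m - 1) * y₁`. -/
def limitVector (m τ₀ k : ℕ) (c : Fin k → ℕ) (i : Fin k) (s : Fin (m + 1)) (j : Fin k) : ℝ :=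
  if (s : ℕ) < m then
    ((m : ℝ) * (τ₀ : ℝ) - (m : ℝ) - 1) / ((m : ℝ) - (s : ℝ))
      * (fallingFactorial ((m : ℝ) - 1) s / fallingFactorial ((m : ℝ) * (τ₀ : ℝ) - 2) s)
      * firstBlock m τ₀ k c i j
  else
    fallingFactorial ((m : ℝ) - 1) (m - 1) / fallingFactorial ((m : ℝ) * (τ₀ : ℝ) - 2) (m - 1)
      * firstBlock m τ₀ k c i j

end

end HookingNetwork

/-!
Fix a degree and let `Y s n` be the number of vertices of the network of age `n` that came with
this degree and have been a latch at least `s` times. The `Y s n - Y (s + 1) n` of them that have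
been a latch exactly `s` times carry `m - s` unused positions each, out of a total of
`m τ₀ + (m τ₀ - m - 1) n`. Given the past, `Y (s + 1)` therefore increases by one with probability
`(m - s) (Y s n - Y (s + 1) n) / (m τ₀ + (m τ₀ - m - 1) n)`, and by the strong law for bounded
martingale differences it stays within `o(n)` of the sum of these probabilities. Solving this
recursion shows that a slope `y` of `Y s` produces the slope `y (m - s) / (m τ₀ - 1 - s)` of
`Y (s + 1)`. Since `Y 0` is affine in `n`, its slope `b` being the number of vertices of that
degree other than the hook in the seed, `Y s` has the slope `b (m)_s / (m τ₀ - 1)_s`, and the limits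
are the differences of consecutive slopes. Apart from their number, only the labels of the vertices
of the seed enter, so the degree can be replaced by an arbitrary label.
-/

namespace HookingNetwork

section Averages

theorem tendsto_div_natCast_zero_iff {u : ℕ → ℝ} :
    Tendsto (fun n : ℕ => u n / n) atTop (𝓝 0) ↔ ∀ ε > 0, ∃ C, ∀ n : ℕ, |u n| ≤ ε * n + C := by
  constructor
  · intro hu ε hε
    obtain ⟨n₀, hn₀⟩ := Metric.tendsto_atTop.1 hu ε hε
    refine ⟨∑ t ∈ Finset.range (n₀ + 1), |u t|, fun n => ?_⟩
    rcases lt_or_ge n (n₀ + 1) with hn | hn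
    · have hsum : |u n| ≤ ∑ t ∈ Finset.range (n₀ + 1), |u t| :=
        Finset.single_le_sum (f := fun t => |u t|) (fun _ _ => abs_nonneg _)
          (Finset.mem_range.2 hn)
      exact hsum.trans (le_add_of_nonneg_left (by positivity))
    · have hpos : (0 : ℝ) < n := by exact_mod_cast (by omega : 0 < n)
      have hdist := hn₀ n (by omega)
      rw [Real.dist_eq, sub_zero, abs_div, Nat.abs_cast, div_lt_iff₀ hpos] at hdist
      exact hdist.le.trans (le_add_of_nonneg_right (by positivity))
  · intro hu
    refine Metric.tendsto_nhds.2 fun ε hε => ?_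
    obtain ⟨C, hC⟩ := hu (ε / 2) (half_pos hε)
    filter_upwards [(tendsto_const_div_atTop_nhds_zero_nat C).eventually_lt_const (half_pos hε),
      eventually_gt_atTop 0] with n hCn hn
    have hpos : (0 : ℝ) < n := by exact_mod_cast hn
    rw [div_lt_iff₀ hpos] at hCn
    rw [Real.dist_eq, sub_zero, abs_div, Nat.abs_cast, div_lt_iff₀ hpos]
    linarith [hC n]

theorem tendsto_div_of_convex_recursion {z δ γ : ℕ → ℝ} (hγ : ∀ n, γ n ∈ Set.Icc 0 1)
    (hz : ∀ n, z (n + 1) = (1 - γ n) * z n + γ n * δ n)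
    (hδ : Tendsto (fun n : ℕ => δ n / n) atTop (𝓝 0)) :
    Tendsto (fun n : ℕ => z n / n) atTop (𝓝 0) := by
  rw [tendsto_div_natCast_zero_iff] at hδ ⊢
  intro ε hε
  obtain ⟨C, hC⟩ := hδ ε hε
  refine ⟨max |z 0| C, fun n => ?_⟩
  induction n with
  | zero => simp
  | succ n ih =>
    have hδn : |δ n| ≤ ε * n + max |z 0| C := (hC n).trans (by gcongr; exact le_max_right _ _)
    have hγ0 : 0 ≤ γ n := (hγ n).1
    have hγ1 : 0 ≤ 1 - γ n := sub_nonneg.2 (hγ n).2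
    calc |z (n + 1)| ≤ (1 - γ n) * |z n| + γ n * |δ n| := by
          simpa only [hz, abs_mul, abs_of_nonneg hγ0, abs_of_nonneg hγ1] using
            abs_add_le ((1 - γ n) * z n) (γ n * δ n)
      _ ≤ (1 - γ n) * (ε * n + max |z 0| C) + γ n * (ε * n + max |z 0| C) := by gcongr
      _ ≤ ε * (n + 1 : ℕ) + max |z 0| C := by push_cast; linarith

/-- The limiting slope `l` of `S` balances its growth against the outflow from `Y - S`, whose
limiting slope is `y - l`: it solves `l = r * (y - l) / a`. -/
theorem tendsto_div_of_proportional_outflow {a b r y : ℝ} (ha : 0 ≤ a) (hb : 0 < b) (hr : 0 ≤ r)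
    (hrb : r ≤ b) {Y S : ℕ → ℝ} (hY : Tendsto (fun n : ℕ => Y n / n) atTop (𝓝 y))
    (hS : Tendsto (fun n : ℕ => (S n - ∑ t ∈ Finset.range n, r * (Y t - S t) / (b + a * t)) / n)
      atTop (𝓝 0)) :
    Tendsto (fun n : ℕ => S n / n) atTop (𝓝 (y * r / (a + r))) := by
  rcases hr.eq_or_lt with rfl | hr
  · simpa using hS
  have hpos : ∀ n : ℕ, 0 < b + a * n := fun n => by positivity
  have har : a + r ≠ 0 := by positivity
  set z : ℕ → ℝ := fun n => ∑ t ∈ Finset.range n, r * (Y t - S t) / (b + a * t) with hz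
  set w : ℕ → ℝ := fun n => z n - y * r / (a + r) * n with hw
  set δ : ℕ → ℝ := fun n => Y n - y * n - (S n - z n) - y * b / (a + r) with hδ
  have hδlim : Tendsto (fun n : ℕ => δ n / n) atTop (𝓝 0) := by
    have h := ((hY.sub_const y).sub hS).sub
      (tendsto_const_div_atTop_nhds_zero_nat (y * b / (a + r)))
    simp only [sub_self] at h
    refine h.congr' ?_
    filter_upwards [eventually_ne_atTop 0] with n hn
    simp only [hδ, hz]
    field_simp
  have hwlim : Tendsto (fun n : ℕ => w n / n) atTop (𝓝 0) := by
    refine tendsto_div_of_convex_recursion (γ := fun n : ℕ => r / (b + a * n)) (fun n => ?_)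
      (fun n => ?_) hδlim
    · have : 0 ≤ a * n := by positivity
      exact ⟨(div_pos hr (hpos n)).le, (div_le_one (hpos n)).2 (by linarith)⟩
    · have := (hpos n).ne'
      simp only [hw, hδ, hz, Finset.sum_range_succ]
      push_cast
      field_simp
      ring
  have h := (hS.add hwlim).add_const (y * r / (a + r))
  simp only [zero_add] at h
  refine h.congr' ?_
  filter_upwards [eventually_ne_atTop 0] with n hn
  simp only [hw]
  field_simp
  ring

theorem tendsto_average_of_tendsto_squares {x : ℕ → ℝ} {C l : ℝ} (hx : ∀ n, C ≤ x n)
    (h : Tendsto (fun n : ℕ => (∑ t ∈ Finset.range (n ^ 2), x t) / (n ^ 2 : ℕ)) atTop (𝓝 l)) :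
    Tendsto (fun n : ℕ => (∑ t ∈ Finset.range n, x t) / n) atTop (𝓝 l) := by
  have hshift : ∀ n ≠ 0, (∑ t ∈ Finset.range n, (x t - C)) / n =
      (∑ t ∈ Finset.range n, x t) / n - C := fun n hn => by
    rw [Finset.sum_sub_distrib, Finset.sum_const, Finset.card_range, nsmul_eq_mul]
    field_simp
  have hmono : Monotone fun n => ∑ t ∈ Finset.range n, (x t - C) :=
    monotone_nat_of_le_succ fun n => by
      rw [Finset.sum_range_succ]
      linarith [hx n]
  have hratio : Tendsto (fun n : ℕ => (1 + 1 / (n : ℝ)) ^ 2) atTop (𝓝 1) := by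
    simpa using ((tendsto_const_div_atTop_nhds_zero_nat (1 : ℝ)).const_add 1).pow 2
  have hlim := tendsto_div_of_monotone_of_exists_subseq_tendsto_div _ (l - C) hmono fun a ha =>
    ⟨fun n => n ^ 2, ?_, tendsto_pow_atTop two_ne_zero, (h.sub_const C).congr' ?_⟩
  · refine (hlim.add_const C).congr' ?_ |>.trans (by rw [sub_add_cancel])
    filter_upwards [eventually_ne_atTop 0] with n hn
    rw [hshift n hn, sub_add_cancel]
  · filter_upwards [hratio.eventually_le_const ha, eventually_ne_atTop 0] with n hn hn0
    calc (((n + 1) ^ 2 : ℕ) : ℝ) = (1 + 1 / (n : ℝ)) ^ 2 * (n ^ 2 : ℕ) := by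
          push_cast
          field_simp
      _ ≤ a * (n ^ 2 : ℕ) := by gcongr
  · filter_upwards [eventually_ne_atTop 0] with n hn
    rw [hshift _ (pow_ne_zero 2 hn)]

end Averages

section Orthogonal

variable {Ω : Type*} [MeasurableSpace Ω] {μ : Measure Ω}

theorem ae_tendsto_zero_of_summable_integral {F : ℕ → Ω → ℝ} (hF0 : ∀ n, 0 ≤ F n)
    (hF : ∀ n, Integrable (F n) μ) (hsum : Summable fun n => ∫ ω, F n ω ∂μ) :
    ∀ᵐ ω ∂μ, Tendsto (fun n => F n ω) atTop (𝓝 0) := by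
  have hmeas : ∀ n, AEMeasurable (fun ω => ENNReal.ofReal (F n ω)) μ := fun n =>
    (hF n).aemeasurable.ennreal_ofReal
  have htop : ∫⁻ ω, ∑' n, ENNReal.ofReal (F n ω) ∂μ ≠ ⊤ := by
    rw [lintegral_tsum hmeas]
    simp only [← ofReal_integral_eq_lintegral_ofReal (hF _) (ae_of_all _ (hF0 _))]
    exact hsum.tsum_ofReal_ne_top
  filter_upwards [ae_lt_top' (AEMeasurable.tsum hmeas) htop] with ω hω
  have h := (ENNReal.tendsto_toReal ENNReal.zero_ne_top).comp
    (ENNReal.tendsto_atTop_zero_of_tsum_ne_top hω.ne)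
  simpa [Function.comp_def, ENNReal.toReal_ofReal (hF0 _ ω)] using h

variable {ξ : ℕ → Ω → ℝ}

theorem integral_sq_sum_of_orthogonal (hξ : ∀ n, MemLp (ξ n) 2 μ)
    (horth : Pairwise fun s t => ∫ ω, ξ s ω * ξ t ω ∂μ = 0) (n : ℕ) :
    ∫ ω, (∑ t ∈ Finset.range n, ξ t ω) ^ 2 ∂μ = ∑ t ∈ Finset.range n, ∫ ω, ξ t ω ^ 2 ∂μ := by
  have hmul : ∀ s t, Integrable (fun ω => ξ s ω * ξ t ω) μ := fun s t =>
    (hξ s).integrable_mul (hξ t)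
  simp only [pow_two, Finset.sum_mul_sum]
  rw [integral_finsetSum _ fun s _ => integrable_finsetSum _ fun t _ => hmul s t]
  refine Finset.sum_congr rfl fun s hs => ?_
  rw [integral_finsetSum _ fun t _ => hmul s t,
    Finset.sum_eq_single_of_mem s hs fun t _ hts => horth hts.symm]

theorem ae_tendsto_average_of_orthogonal [IsFiniteMeasure μ] {C : ℝ}
    (hξ : ∀ n, AEStronglyMeasurable (ξ n) μ)
    (hbd : ∀ n ω, |ξ n ω| ≤ C) (horth : Pairwise fun s t => ∫ ω, ξ s ω * ξ t ω ∂μ = 0) :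
    ∀ᵐ ω ∂μ, Tendsto (fun n : ℕ => (∑ t ∈ Finset.range n, ξ t ω) / n) atTop (𝓝 0) := by
  have hL2 : ∀ n, MemLp (ξ n) 2 μ := fun n => MemLp.of_bound (hξ n) C (ae_of_all _ (hbd n))
  have hint : ∀ n : ℕ, Integrable
      (fun ω => ((∑ t ∈ Finset.range (n ^ 2), ξ t ω) / (n ^ 2 : ℕ)) ^ 2) μ := fun n => by
    simp only [div_pow]
    exact ((memLp_finsetSum _ fun t _ => hL2 t).integrable_sq).div_const _
  have hsq : ∀ t, ∫ ω, ξ t ω ^ 2 ∂μ ≤ C ^ 2 * μ.real Set.univ := fun t => by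
    calc ∫ ω, ξ t ω ^ 2 ∂μ ≤ ∫ _, C ^ 2 ∂μ :=
          integral_mono (hL2 t).integrable_sq (integrable_const _) fun ω =>
            sq_le_sq' (abs_le.1 (hbd t ω)).1 (abs_le.1 (hbd t ω)).2
      _ = C ^ 2 * μ.real Set.univ := by rw [integral_const, smul_eq_mul, mul_comm]
  have hle : ∀ n : ℕ, ∫ ω, ((∑ t ∈ Finset.range (n ^ 2), ξ t ω) / (n ^ 2 : ℕ)) ^ 2 ∂μ ≤
      C ^ 2 * μ.real Set.univ * (1 / (n : ℝ) ^ 2) := fun n => by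
    simp only [div_pow]
    rw [integral_div, integral_sq_sum_of_orthogonal hL2 horth]
    calc (∑ t ∈ Finset.range (n ^ 2), ∫ ω, ξ t ω ^ 2 ∂μ) / ((n ^ 2 : ℕ) : ℝ) ^ 2
        ≤ ((n ^ 2 : ℕ) * (C ^ 2 * μ.real Set.univ)) / ((n ^ 2 : ℕ) : ℝ) ^ 2 := by
          gcongr
          simpa only [Finset.sum_const, Finset.card_range, nsmul_eq_mul] using
            Finset.sum_le_sum fun t (_ : t ∈ Finset.range (n ^ 2)) => hsq t
      _ = C ^ 2 * μ.real Set.univ * (1 / (n : ℝ) ^ 2) := by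
          rcases eq_or_ne n 0 with rfl | hn
          · simp
          · push_cast
            field_simp
  have hsum := Summable.of_nonneg_of_le (fun n => integral_nonneg fun ω => sq_nonneg _) hle
    ((Real.summable_one_div_nat_pow.2 one_lt_two).mul_left _)
  filter_upwards [ae_tendsto_zero_of_summable_integral (fun n ω => sq_nonneg _) hint hsum] with ω hω
  refine tendsto_average_of_tendsto_squares (fun n => (abs_le.1 (hbd n ω)).1) ?_
  have habs := hω.sqrt
  simp only [Real.sqrt_sq_eq_abs, Real.sqrt_zero] at habs
  exact (tendsto_zero_iff_abs_tendsto_zero _).2 habs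

end Orthogonal

section UniformSampling

open PiNat

variable {Ω P : Type*} [MeasurableSpace Ω] {μ : Measure Ω} {X : Ω → ℕ → P}
  {A C : ℕ → (ℕ → P) → Set P} {n : ℕ} {q : ℕ → P}

/-- The random sequence `X` is sampled uniformly without knowledge of the future: given the first
`n` terms, the term `X ω n` is uniformly distributed over the finite set `A n (X ω)`, which is
determined by these terms. The conditioning is expressed on cylinders, so that neither a σ-algebra
nor countability is needed on `P`. -/
structure IsUniformSampling (A : ℕ → (ℕ → P) → Set P) (μ : Measure Ω) (X : Ω → ℕ → P) :
    Prop where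
  finite : ∀ n q, (A n q).Finite
  dependsOn : ∀ n, DependsOn (A n) (Set.Iio n)
  measurableSet_eq : ∀ n x, MeasurableSet {ω | X ω n = x}
  mem : ∀ᵐ ω ∂μ, ∀ n, X ω n ∈ A n (X ω)
  measure_cylinder_succ : ∀ n q, q n ∈ A n q →
    μ (X ⁻¹' cylinder q (n + 1)) = μ (X ⁻¹' cylinder q n) / (A n q).ncard

/-- The indicator of the event that the term `n` of a sequence, sampled uniformly from `A`, falls
into `C`, minus its conditional probability given the previous terms. -/
noncomputable def centredIndicator (A C : ℕ → (ℕ → P) → Set P) (n : ℕ) (q : ℕ → P) : ℝ :=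
  (C n q).indicator 1 (q n) - (C n q ∩ A n q).ncard / (A n q).ncard

theorem eq_of_mem_cylinder {β : Type*} {f : (ℕ → P) → β} {x : ℕ → P}
    (hf : DependsOn f (Set.Iio n)) (hx : x ∈ cylinder q n) : f x = f q :=
  hf fun t ht => mem_cylinder_iff.1 hx t ht

theorem dependsOn_centredIndicator (hA : DependsOn (A n) (Set.Iio n))
    (hC : DependsOn (C n) (Set.Iio n)) :
    DependsOn (centredIndicator A C n) (Set.Iio (n + 1)) := fun q q' h => by
  have h' : ∀ t ∈ Set.Iio n, q t = q' t := fun t ht => h t (Nat.lt_succ_of_lt ht)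
  rw [centredIndicator, centredIndicator, hA h', hC h', h n (Nat.lt_succ_self n)]

theorem abs_centredIndicator_le_one : |centredIndicator A C n q| ≤ 1 := by
  have hfreq : ((C n q ∩ A n q).ncard : ℝ) / (A n q).ncard ≤ 1 := by
    rcases (A n q).finite_or_infinite with h | h
    · exact div_le_one_of_le₀ (by exact_mod_cast Set.ncard_inter_le_ncard_right _ _ h)
        (Nat.cast_nonneg _)
    · simp [h.ncard]
  have hfreq0 : 0 ≤ ((C n q ∩ A n q).ncard : ℝ) / (A n q).ncard := by positivity
  by_cases hq : q n ∈ C n q <;> simp only [centredIndicator, hq, Set.indicator_of_mem,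
    Set.indicator_of_notMem, not_false_eq_true, Pi.one_apply, abs_le] <;> constructor <;> linarith

namespace IsUniformSampling

theorem measurableSet_cylinder (h : IsUniformSampling A μ X) (n : ℕ) (q : ℕ → P) :
    MeasurableSet (X ⁻¹' cylinder q n) := by
  have : X ⁻¹' cylinder q n = ⋂ t ∈ Set.Iio n, {ω | X ω t = q t} := by
    ext ω
    simp [mem_cylinder_iff]
  rw [this]
  exact MeasurableSet.biInter (Set.to_countable _) fun t _ => h.measurableSet_eq t _

theorem ae_mem_cylinder_update (h : IsUniformSampling A μ X) (n : ℕ) :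
    ∀ᵐ ω ∂μ, ∀ q, X ω ∈ cylinder q n →
      ∃ x ∈ A n q, X ω ∈ cylinder (Function.update q n x) (n + 1) := by
  filter_upwards [h.mem] with ω hω q hq
  refine ⟨X ω n, eq_of_mem_cylinder (h.dependsOn n) hq ▸ hω n, mem_cylinder_iff.2 fun t ht => ?_⟩
  rcases Nat.lt_succ_iff_lt_or_eq.1 ht with ht | rfl
  · rw [Function.update_of_ne ht.ne, mem_cylinder_iff.1 hq t ht]
  · rw [Function.update_self]

theorem exists_finite_cylinder_cover (h : IsUniformSampling A μ X) (n : ℕ) :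
    ∃ H : Set (ℕ → P), H.Finite ∧ ∀ᵐ ω ∂μ, ∃ q ∈ H, X ω ∈ cylinder q n := by
  induction n with
  | zero =>
    rcases isEmpty_or_nonempty Ω with hΩ | ⟨⟨ω₀⟩⟩
    · exact ⟨∅, Set.finite_empty, ae_of_all _ hΩ.elim⟩
    · exact ⟨{X ω₀}, Set.finite_singleton _, ae_of_all _ fun ω => ⟨X ω₀, rfl, by simp⟩⟩
  | succ n ih =>
    obtain ⟨H, hH, hcover⟩ := ih
    refine ⟨⋃ q ∈ H, Function.update q n '' A n q,
      hH.biUnion fun q _ => (h.finite n q).image _, ?_⟩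
    filter_upwards [hcover, h.ae_mem_cylinder_update n] with ω ⟨q, hqH, hq⟩ hω
    obtain ⟨x, hx, hωx⟩ := hω q hq
    exact ⟨_, Set.mem_biUnion hqH (Set.mem_image_of_mem _ hx), hωx⟩

theorem aestronglyMeasurable_comp (h : IsUniformSampling A μ X) {f : (ℕ → P) → ℝ}
    (hf : DependsOn f (Set.Iio n)) : AEStronglyMeasurable (f ∘ X) μ := by
  obtain ⟨H, hH, hcover⟩ := h.exists_finite_cylinder_cover n
  have := hH.countable.to_subtype
  have hrestrict : μ.restrict (⋃ q : H, X ⁻¹' cylinder (q : ℕ → P) n) = μ := by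
    refine Measure.restrict_eq_self_of_ae_mem ?_
    simpa using hcover
  rw [← hrestrict]
  refine AEStronglyMeasurable.iUnion fun q => ?_
  refine (aestronglyMeasurable_const (b := f q)).congr ?_
  filter_upwards [ae_restrict_mem (h.measurableSet_cylinder n q)] with ω hω
  exact (eq_of_mem_cylinder hf hω).symm

theorem integral_eq_zero_of_cylinders (h : IsUniformSampling A μ X) {f : Ω → ℝ}
    (hf : Integrable f μ) (hcyl : ∀ q, ∫ ω in X ⁻¹' cylinder q n, f ω ∂μ = 0) :
    ∫ ω, f ω ∂μ = 0 := by
  obtain ⟨H, hH, hcover⟩ := h.exists_finite_cylinder_cover n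
  set S := (hH.image fun q => X ⁻¹' cylinder q n).toFinset with hS
  have hmem : ∀ E ∈ S, ∃ q, X ⁻¹' cylinder q n = E := fun E hE => by
    obtain ⟨q, -, hq⟩ := (Set.Finite.mem_toFinset _).1 hE
    exact ⟨q, hq⟩
  have hrestrict : μ.restrict (⋃ E ∈ S, E) = μ := by
    refine Measure.restrict_eq_self_of_ae_mem ?_
    simpa [hS] using hcover
  rw [← hrestrict, integral_biUnion_finset]
  · refine Finset.sum_eq_zero fun E hE => ?_
    obtain ⟨q, rfl⟩ := hmem E hE
    exact hcyl q
  · intro E hE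
    obtain ⟨q, rfl⟩ := hmem E hE
    exact h.measurableSet_cylinder n q
  · intro E hE E' hE' hne
    obtain ⟨q, rfl⟩ := hmem E hE
    obtain ⟨q', rfl⟩ := hmem E' hE'
    refine Set.disjoint_left.2 fun ω hω hω' => hne ?_
    rw [← mem_cylinder_iff_eq.1 hω, ← mem_cylinder_iff_eq.1 hω']
  · exact fun E _ => hf.integrableOn

theorem preimage_cylinder_ae_eq (h : IsUniformSampling A μ X) (n : ℕ) (q : ℕ → P) :
    X ⁻¹' cylinder q n =ᵐ[μ]
      ⋃ x ∈ (h.finite n q).toFinset, X ⁻¹' cylinder (Function.update q n x) (n + 1) := by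
  refine eventuallyEq_set.2 ?_
  filter_upwards [h.ae_mem_cylinder_update n] with ω hω
  refine ⟨fun hq => ?_, fun hq => ?_⟩
  · obtain ⟨x, hx, hωx⟩ := hω q hq
    exact Set.mem_biUnion ((h.finite n q).mem_toFinset.2 hx) hωx
  · obtain ⟨x, -, hx⟩ := Set.mem_iUnion₂.1 hq
    rw [Set.mem_preimage, ← mem_cylinder_iff_eq.1 (update_mem_cylinder q n x)]
    exact cylinder_anti _ (Nat.le_succ n) hx

theorem measureReal_cylinder_update (h : IsUniformSampling A μ X) {x : P} (hx : x ∈ A n q) :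
    μ.real (X ⁻¹' cylinder (Function.update q n x) (n + 1)) =
      μ.real (X ⁻¹' cylinder q n) / (A n q).ncard := by
  have hA : A n (Function.update q n x) = A n q :=
    eq_of_mem_cylinder (h.dependsOn n) (update_mem_cylinder q n x)
  have hμ := h.measure_cylinder_succ n (Function.update q n x)
    (by rwa [hA, Function.update_self])
  rw [mem_cylinder_iff_eq.1 (update_mem_cylinder q n x), hA] at hμ
  simp only [measureReal_def, hμ, ENNReal.toReal_div, ENNReal.toReal_natCast]

variable [IsFiniteMeasure μ]

theorem setIntegral_cylinder (h : IsUniformSampling A μ X) (g : P → ℝ) (n : ℕ) (q : ℕ → P) :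
    ∫ ω in X ⁻¹' cylinder q n, g (X ω n) ∂μ =
      μ.real (X ⁻¹' cylinder q n) * ((∑ x ∈ (h.finite n q).toFinset, g x) / (A n q).ncard) := by
  have hterm : ∀ x, ∀ ω ∈ X ⁻¹' cylinder (Function.update q n x) (n + 1), X ω n = x :=
    fun x ω hω => by
      rw [mem_cylinder_iff.1 hω n (Nat.lt_succ_self n), Function.update_self]
  rw [setIntegral_congr_set (h.preimage_cylinder_ae_eq n q), integral_biUnion_finset]
  · rw [Finset.sum_div, Finset.mul_sum]
    refine Finset.sum_congr rfl fun x hx => ?_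
    rw [setIntegral_congr_fun (g := fun _ => g x) (h.measurableSet_cylinder _ _)
      fun ω hω => by rw [hterm x ω hω], setIntegral_const,
      h.measureReal_cylinder_update ((Set.Finite.mem_toFinset _).1 hx), smul_eq_mul]
    ring
  · exact fun x _ => h.measurableSet_cylinder _ _
  · intro x _ y _ hxy
    exact Set.disjoint_left.2 fun ω hx hy => hxy ((hterm x ω hx).symm.trans (hterm y ω hy))
  · intro x _
    exact (integrableOn_const (C := g x)).congr_fun (fun ω hω => by rw [hterm x ω hω])
      (h.measurableSet_cylinder _ _)

theorem setIntegral_cylinder_centredIndicator (h : IsUniformSampling A μ X)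
    (hC : DependsOn (C n) (Set.Iio n)) (q : ℕ → P) :
    ∫ ω in X ⁻¹' cylinder q n, centredIndicator A C n (X ω) ∂μ = 0 := by
  classical
  set ρ : ℝ := (C n q ∩ A n q).ncard / (A n q).ncard
  have hcongr : ∀ ω ∈ X ⁻¹' cylinder q n,
      centredIndicator A C n (X ω) = (C n q).indicator 1 (X ω n) - ρ := fun ω hω => by
    rw [centredIndicator, eq_of_mem_cylinder (h.dependsOn n) hω, eq_of_mem_cylinder hC hω]
  rw [setIntegral_congr_fun (h.measurableSet_cylinder n q) hcongr,
    h.setIntegral_cylinder (fun x => (C n q).indicator 1 x - ρ) n q]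
  have hcount : ∑ x ∈ (h.finite n q).toFinset, (C n q).indicator (1 : P → ℝ) x =
      (C n q ∩ A n q).ncard := by
    rw [Finset.sum_indicator_eq_sum_filter]
    simp [← Set.ncard_coe_finset, Set.inter_comm, Set.sep_mem_eq]
  have hcard : ((A n q).ncard : ℝ) * ρ = (C n q ∩ A n q).ncard :=
    mul_div_cancel_of_imp' fun h0 => by
      have hle := Set.ncard_inter_le_ncard_right (C n q) _ (h.finite n q)
      norm_cast at h0 ⊢
      omega
  rw [Finset.sum_sub_distrib, hcount, Finset.sum_const, nsmul_eq_mul,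
    ← Set.ncard_eq_toFinset_card _ (h.finite n q), hcard, sub_self, zero_div, mul_zero]

theorem integral_centredIndicator_mul (h : IsUniformSampling A μ X)
    (hC : ∀ n, DependsOn (C n) (Set.Iio n)) {s t : ℕ} (hst : s < t) :
    ∫ ω, centredIndicator A C s (X ω) * centredIndicator A C t (X ω) ∂μ = 0 := by
  have hdep := fun n => dependsOn_centredIndicator (h.dependsOn n) (hC n)
  refine h.integral_eq_zero_of_cylinders (n := t) ?_ fun q => ?_
  · refine Integrable.of_bound ((h.aestronglyMeasurable_comp (hdep s)).mul
      (h.aestronglyMeasurable_comp (hdep t))) 1 (ae_of_all _ fun ω => ?_)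
    rw [norm_mul]
    exact mul_le_one₀ abs_centredIndicator_le_one (norm_nonneg _) abs_centredIndicator_le_one
  · have hcongr : ∀ ω ∈ X ⁻¹' cylinder q t,
        centredIndicator A C s (X ω) * centredIndicator A C t (X ω) =
          centredIndicator A C s q * centredIndicator A C t (X ω) := fun ω hω => by
      rw [eq_of_mem_cylinder (hdep s) (cylinder_anti q hst hω)]
    rw [setIntegral_congr_fun (h.measurableSet_cylinder t q) hcongr, integral_const_mul,
      h.setIntegral_cylinder_centredIndicator (hC t), mul_zero]

theorem ae_tendsto_average_centredIndicator (h : IsUniformSampling A μ X)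
    (hC : ∀ n, DependsOn (C n) (Set.Iio n)) :
    ∀ᵐ ω ∂μ, Tendsto (fun n : ℕ => (∑ t ∈ Finset.range n, centredIndicator A C t (X ω)) / n)
      atTop (𝓝 0) := by
  refine ae_tendsto_average_of_orthogonal (fun n => h.aestronglyMeasurable_comp
    (dependsOn_centredIndicator (h.dependsOn n) (hC n)))
    (fun n ω => abs_centredIndicator_le_one) fun s t hst => ?_
  rcases hst.lt_or_gt with hlt | hlt
  · exact h.integral_centredIndicator_mul hC hlt
  · simpa only [mul_comm] using h.integral_centredIndicator_mul hC hlt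

end IsUniformSampling

end UniformSampling

section Growth

variable {α β ι : Type*} {G : Graph α β} {hook : α} {m : ℕ} {f : α → ι} {x : ι} {n s : ℕ}
  {latch : ℕ → ℕ × α} {q : ℕ → Position α m}

theorem dependsOn_network_vertexSet (G : Graph α β) (hook : α) (n : ℕ) :
    DependsOn (fun latch => (network G hook latch n).vertexSet) (Set.Iio n) := by
  intro latch latch' h
  have hplace : ∀ t ≤ n, place hook latch t = place hook latch' t := by
    rintro (_ | t) ht
    · rfl
    · funext v
      simp only [place, h t ht]
  exact Set.ext fun y => exists_congr fun t => and_congr_right fun ht => by rw [hplace t ht]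

theorem dependsOn_timesLatched (n : ℕ) (y : ℕ × α) :
    DependsOn (fun latch => timesLatched latch n y) (Set.Iio n) := fun latch latch' h =>
  congrArg Set.ncard <| Set.ext fun t => and_congr_right fun ht => by rw [h t ht]

theorem dependsOn_available (G : Graph α β) (hook : α) (m n : ℕ) :
    DependsOn (fun q : ℕ → Position α m => available G hook q n) (Set.Iio n) := by
  intro q q' h
  have hlatch : ∀ t ∈ Set.Iio n, latches q t = latches q' t := fun t ht =>
    congrArg Prod.fst (h t ht)
  refine Set.ext fun z => and_congr ?_ (forall₂_congr fun t ht => by rw [h t ht])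
  exact Set.ext_iff.1 (dependsOn_network_vertexSet G hook n hlatch) z.1

theorem finite_network_vertexSet (hV : G.vertexSet.Finite) (latch : ℕ → ℕ × α) (n : ℕ) :
    (network G hook latch n).vertexSet.Finite := by
  refine ((Set.finite_Iic n).biUnion fun t _ => hV.image (place hook latch t)).subset ?_
  rintro y ⟨t, ht, v, hv, rfl⟩
  exact Set.mem_biUnion ht (Set.mem_image_of_mem _ hv)

theorem finite_available (hV : G.vertexSet.Finite) (q : ℕ → Position α m) (n : ℕ) :
    (available G hook q n).Finite :=
  ((finite_network_vertexSet hV (latches q) n).prod Set.finite_univ).subset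
    fun _ hz => ⟨hz.1, Set.mem_univ _⟩

open Classical in
theorem timesLatched_eq_count (latch : ℕ → ℕ × α) (n : ℕ) (y : ℕ × α) :
    timesLatched latch n y = Nat.count (fun t => latch t = y) n := by
  rw [Nat.count_eq_card_filter_range, ← Set.ncard_coe_finset]
  simp [timesLatched]

open Classical in
theorem timesLatched_succ (latch : ℕ → ℕ × α) (n : ℕ) (y : ℕ × α) :
    timesLatched latch (n + 1) y = timesLatched latch n y + if latch n = y then 1 else 0 := by
  rw [timesLatched_eq_count, timesLatched_eq_count, Nat.count_succ]

theorem ncard_setOf_latch_mem {W : Set (ℕ × α)} (hW : W.Finite)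
    (hs : ∀ y ∈ W, timesLatched latch n y = s) : {t | t < n ∧ latch t ∈ W}.ncard = s * W.ncard := by
  classical
  have hfiber := Finset.sum_card_fiberwise_eq_card_filter (Finset.range n) hW.toFinset latch
  rw [Finset.sum_congr rfl fun y hy => by
    rw [← Nat.count_eq_card_filter_range, ← timesLatched_eq_count, hs y (hW.mem_toFinset.1 hy)],
    Finset.sum_const, smul_eq_mul, ← Set.ncard_eq_toFinset_card _ hW, mul_comm] at hfiber
  rw [hfiber, ← Set.ncard_coe_finset]
  simp

/-- A sequence of insertion positions that can be chosen one after another. -/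
def IsAdmissible (G : Graph α β) (hook : α) (q : ℕ → Position α m) : Prop :=
  ∀ n, q n ∈ available G hook q n

namespace IsAdmissible

theorem injective (hq : IsAdmissible G hook q) : Function.Injective q := by
  intro s t hst
  rcases lt_trichotomy s t with h | h | h
  · exact absurd hst ((hq t).2 s h)
  · exact h
  · exact absurd hst.symm ((hq s).2 t h)

theorem network_vertexSet_eq (hq : IsAdmissible G hook q) (n : ℕ) :
    (network G hook (latches q) n).vertexSet =
      {0} ×ˢ G.vertexSet ∪ Set.Icc 1 n ×ˢ (G.vertexSet \ {hook}) := by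
  induction n using Nat.strong_induction_on with | _ n ih
  ext y
  constructor
  · rintro ⟨_ | t, ht, v, hv, rfl⟩
    · exact Or.inl ⟨rfl, hv⟩
    · by_cases hvh : v = hook
      · have hlatch := (hq t).1
        rw [ih t ht] at hlatch
        simp only [place, if_pos hvh]
        exact hlatch.imp_right fun h => ⟨⟨h.1.1, h.1.2.trans (by omega)⟩, h.2⟩
      · simp only [place, if_neg hvh]
        exact Or.inr ⟨⟨by omega, ht⟩, hv, hvh⟩
  · obtain ⟨t, v⟩ := y
    rintro (⟨rfl, hv⟩ | ⟨⟨h1, hn⟩, hv, hvh⟩)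
    · exact ⟨0, Nat.zero_le n, v, hv, rfl⟩
    · obtain ⟨t, rfl⟩ := Nat.exists_eq_succ_of_ne_zero (Nat.one_le_iff_ne_zero.1 h1)
      exact ⟨t + 1, hn, v, hv, if_neg hvh⟩

theorem ncard_network_vertexSet_inter (hq : IsAdmissible G hook q) (hV : G.vertexSet.Finite)
    (W : Set α) (n : ℕ) : ((network G hook (latches q) n).vertexSet ∩ Prod.snd ⁻¹' W).ncard =
      (G.vertexSet ∩ W).ncard + n * ((G.vertexSet ∩ W) \ {hook}).ncard := by
  have hW := hV.inter_of_left W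
  have hset : (network G hook (latches q) n).vertexSet ∩ Prod.snd ⁻¹' W =
      {0} ×ˢ (G.vertexSet ∩ W) ∪ Set.Icc 1 n ×ˢ ((G.vertexSet ∩ W) \ {hook}) := by
    rw [hq.network_vertexSet_eq]
    ext y
    simp only [Set.mem_inter_iff, Set.mem_union, Set.mem_prod, Set.mem_sdiff, Set.mem_preimage]
    tauto
  have hdisj : Disjoint ({0} : Set ℕ) (Set.Icc 1 n) := by simp
  rw [hset, Set.ncard_union_eq (Set.disjoint_prod.2 (Or.inl hdisj))
    ((Set.finite_singleton 0).prod hW) ((Set.finite_Icc 1 n).prod hW.sdiff), Set.ncard_prod,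
    Set.ncard_prod, Set.ncard_singleton, one_mul, Set.ncard_eq_toFinset_card' (Set.Icc 1 n)]
  simp

theorem latches_mem (hq : IsAdmissible G hook q) {t : ℕ} (ht : t < n) :
    latches q t ∈ (network G hook (latches q) n).vertexSet := by
  obtain ⟨u, hu, hplace⟩ := (hq t).1
  exact ⟨u, hu.trans ht.le, hplace⟩

theorem mem_network_of_timesLatched_pos (hq : IsAdmissible G hook q) {y : ℕ × α}
    (hy : 0 < timesLatched (latches q) n y) : y ∈ (network G hook (latches q) n).vertexSet := by
  obtain ⟨t, ht, rfl⟩ := Set.nonempty_of_ncard_ne_zero hy.ne'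
  exact hq.latches_mem ht

theorem ncard_available_add (hq : IsAdmissible G hook q) {W : Set (ℕ × α)} (hW : W.Finite)
    (hsub : W ⊆ (network G hook (latches q) n).vertexSet) :
    (Prod.fst ⁻¹' W ∩ available G hook q n).ncard + {t | t < n ∧ latches q t ∈ W}.ncard =
      m * W.ncard := by
  have hset : Prod.fst ⁻¹' W ∩ available G hook q n =
      (W ×ˢ Set.univ) \ (q '' {t | t < n ∧ latches q t ∈ W}) := by
    ext z
    constructor
    · rintro ⟨hzW, -, hz⟩
      exact ⟨⟨hzW, trivial⟩, fun ⟨t, ht, htz⟩ => hz t ht.1 htz⟩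
    · rintro ⟨⟨hzW, -⟩, hz⟩
      exact ⟨hzW, hsub hzW, fun t ht htz => hz ⟨t, ⟨ht, by rwa [latches, htz]⟩, htz⟩⟩
  have himage : q '' {t | t < n ∧ latches q t ∈ W} ⊆ W ×ˢ Set.univ := by
    rintro _ ⟨t, ht, rfl⟩
    exact ⟨ht.2, trivial⟩
  have h := Set.ncard_sdiff_add_ncard_of_subset himage (hW.prod Set.finite_univ)
  rwa [← hset, Set.ncard_image_of_injective _ hq.injective, Set.ncard_prod, Set.ncard_univ,
    Nat.card_fin, mul_comm] at h

theorem ncard_available (hq : IsAdmissible G hook q) (hV : G.vertexSet.Finite)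
    (hhook : hook ∈ G.vertexSet) (n : ℕ) : ((available G hook q n).ncard : ℝ) =
      m * G.vertexSet.ncard + (m * G.vertexSet.ncard - m - 1) * n := by
  have hcount := hq.ncard_available_add (finite_network_vertexSet hV _ n) subset_rfl
  have hall : {t | t < n ∧ latches q t ∈ (network G hook (latches q) n).vertexSet} = Set.Iio n :=
    Set.ext fun t => and_iff_left_of_imp hq.latches_mem
  have havail : Prod.fst ⁻¹' (network G hook (latches q) n).vertexSet ∩ available G hook q n =
      available G hook q n := Set.inter_eq_right.2 fun z hz => hz.1
  have hnetwork := hq.ncard_network_vertexSet_inter hV Set.univ n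
  rw [Set.preimage_univ, Set.inter_univ, Set.inter_univ] at hnetwork
  rw [hall, havail, hnetwork, Set.ncard_eq_toFinset_card' (Set.Iio n), Set.toFinset_Iio,
    Nat.card_Iio] at hcount
  have hτ := Set.ncard_sdiff_singleton_add_one hhook hV
  have hcount' := congrArg (Nat.cast (R := ℝ)) hcount
  have hτ' := congrArg (Nat.cast (R := ℝ)) hτ
  push_cast at hcount' hτ'
  linear_combination hcount' + m * n * hτ'

theorem mul_ncard_sub_sub_one_nonneg (hq : IsAdmissible G hook q) (hV : G.vertexSet.Finite)
    (hhook : hook ∈ G.vertexSet) : 0 ≤ (m : ℝ) * G.vertexSet.ncard - m - 1 := by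
  by_contra! hneg
  obtain ⟨n, hn⟩ := exists_nat_gt ((m * G.vertexSet.ncard : ℝ) / -(m * G.vertexSet.ncard - m - 1))
  rw [div_lt_iff₀ (neg_pos.2 hneg)] at hn
  have hcard : (0 : ℝ) ≤ (available G hook q n).ncard := Nat.cast_nonneg _
  rw [hq.ncard_available hV hhook] at hcard
  linarith

end IsAdmissible

/-- The number of vertices of the network of age `n` that have latched `s` times and whose original
label is `x`, for an arbitrary labelling `f` of the vertices of the seed. For `f = deg G` this is
`degreeCount`. -/
noncomputable def labelCount (G : Graph α β) (hook : α) (f : α → ι) (latch : ℕ → ℕ × α)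
    (n : ℕ) (x : ι) (s : ℕ) : ℕ :=
  {y ∈ (network G hook latch n).vertexSet | f y.2 = x ∧ timesLatched latch n y = s}.ncard

/-- The number of vertices of the network of age `n` that have latched at least `s` times and whose
original label is `x`. Unlike `labelCount`, it never decreases when a latch is chosen. -/
noncomputable def tailCount (G : Graph α β) (hook : α) (f : α → ι) (latch : ℕ → ℕ × α)
    (n : ℕ) (x : ι) (s : ℕ) : ℕ :=
  {y ∈ (network G hook latch n).vertexSet | f y.2 = x ∧ s ≤ timesLatched latch n y}.ncard

/-- The insertion positions at vertices of original label `x` that have latched `s` times: the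
colour `(s, x)` of the urn. -/
def colourClass (f : α → ι) (x : ι) (s n : ℕ) (q : ℕ → Position α m) : Set (Position α m) :=
  {z | f z.1.2 = x ∧ timesLatched (latches q) n z.1 = s}

theorem dependsOn_colourClass (f : α → ι) (x : ι) (s m n : ℕ) :
    DependsOn (colourClass (m := m) f x s n) (Set.Iio n) := by
  intro q q' h
  exact Set.ext fun z => and_congr_right fun _ =>
    Eq.congr_left (dependsOn_timesLatched n z.1 fun t ht => congrArg Prod.fst (h t ht))

theorem tailCount_eq_labelCount_add (hV : G.vertexSet.Finite) (latch : ℕ → ℕ × α) (n : ℕ)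
    (x : ι) (s : ℕ) : tailCount G hook f latch n x s =
      labelCount G hook f latch n x s + tailCount G hook f latch n x (s + 1) := by
  have hfin := finite_network_vertexSet (hook := hook) hV latch n
  rw [tailCount, tailCount, labelCount, ← Set.ncard_union_eq ?_ (hfin.sep _) (hfin.sep _)]
  · congr 1
    ext y
    simp only [Set.mem_union, Set.mem_ofPred_eq, ← and_or_left]
    grind
  · exact Set.disjoint_left.2 fun y hy hy' => by grind

namespace IsAdmissible

theorem tailCount_zero (hq : IsAdmissible G hook q) (hV : G.vertexSet.Finite) (n : ℕ) (x : ι) :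
    tailCount G hook f (latches q) n x 0 =
      {v ∈ G.vertexSet | f v = x}.ncard + n * ({v ∈ G.vertexSet | f v = x} \ {hook}).ncard := by
  have h := hq.ncard_network_vertexSet_inter hV (f ⁻¹' {x}) n
  simp only [tailCount, Nat.zero_le, and_true]
  exact h

theorem tailCount_succ_eq_ncard (hq : IsAdmissible G hook q) (n : ℕ) (x : ι) (s : ℕ) :
    tailCount G hook f (latches q) n x (s + 1) =
      {y : ℕ × α | f y.2 = x ∧ s < timesLatched (latches q) n y}.ncard :=
  congrArg Set.ncard <| Set.ext fun _ => and_iff_right_of_imp fun hy =>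
    hq.mem_network_of_timesLatched_pos (Nat.zero_lt_of_lt hy.2)

open Classical in
theorem tailCount_succ_succ (hq : IsAdmissible G hook q) (hV : G.vertexSet.Finite) (n : ℕ) (x : ι)
    (s : ℕ) : tailCount G hook f (latches q) (n + 1) x (s + 1) =
      tailCount G hook f (latches q) n x (s + 1) +
        if q n ∈ colourClass f x s n q then 1 else 0 := by
  have hfin : {y : ℕ × α | f y.2 = x ∧ s < timesLatched (latches q) n y}.Finite :=
    (finite_network_vertexSet hV (latches q) n).subset fun y hy =>
      hq.mem_network_of_timesLatched_pos (Nat.zero_lt_of_lt hy.2)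
  simp only [hq.tailCount_succ_eq_ncard, timesLatched_succ]
  split_ifs with hn
  · have hnot : latches q n ∉ {y : ℕ × α | f y.2 = x ∧ s < timesLatched (latches q) n y} :=
      fun h => h.2.ne' hn.2
    rw [← Set.ncard_insert_of_notMem hnot hfin]
    congr 1
    ext y
    have hmem := hn
    simp only [colourClass, Set.mem_ofPred_eq, Set.mem_insert_iff, latches] at hmem ⊢
    grind
  · congr 1
    ext y
    simp only [colourClass, Set.mem_ofPred_eq, latches] at hn ⊢
    grind

theorem tailCount_succ_eq_sum (hq : IsAdmissible G hook q) (hV : G.vertexSet.Finite) (n : ℕ)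
    (x : ι) (s : ℕ) : (tailCount G hook f (latches q) n x (s + 1) : ℝ) =
      ∑ t ∈ Finset.range n, (colourClass f x s t q).indicator 1 (q t) := by
  classical
  induction n with
  | zero => simp [tailCount, timesLatched]
  | succ n ih =>
    rw [hq.tailCount_succ_succ hV, Finset.sum_range_succ, ← ih, Set.indicator_apply]
    push_cast
    rfl

theorem ncard_colourClass_inter_available (hq : IsAdmissible G hook q) (hV : G.vertexSet.Finite)
    (n : ℕ) (x : ι) (s : ℕ) : ((colourClass f x s n q ∩ available G hook q n).ncard : ℝ) =
      (m - s) * labelCount G hook f (latches q) n x s := by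
  set W := {y ∈ (network G hook (latches q) n).vertexSet |
    f y.2 = x ∧ timesLatched (latches q) n y = s} with hWdef
  have hW : W.Finite := (finite_network_vertexSet hV _ n).sep _
  have hset : Prod.fst ⁻¹' W ∩ available G hook q n =
      colourClass f x s n q ∩ available G hook q n :=
    Set.ext fun z => and_congr_left fun hz => and_iff_right hz.1
  have hcount := hq.ncard_available_add hW fun y hy => hy.1
  rw [hset, ncard_setOf_latch_mem hW fun y hy => hy.2.2] at hcount
  have hcount' := congrArg (Nat.cast (R := ℝ)) hcount
  push_cast at hcount'
  rw [labelCount, ← hWdef]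
  linear_combination hcount'

end IsAdmissible

theorem IsUniformGrowth.isUniformSampling {Ω : Type*} [MeasurableSpace Ω] {μ : Measure Ω}
    {p : ℕ → Ω → Position α m} (hp : IsUniformGrowth G hook m μ p) (hV : G.vertexSet.Finite) :
    IsUniformSampling (fun n q => available G hook q n) μ fun ω t => p t ω where
  finite n q := finite_available hV q n
  dependsOn n := dependsOn_available G hook m n
  measurableSet_eq := hp.measurableSet_eq
  mem := hp.mem_available
  measure_cylinder_succ n q hq := by
    simpa [PiNat.cylinder, Nat.lt_succ_iff] using hp.uniform n q hq

end Growth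

section Limit

theorem fallingFactorial_succ' (x : ℝ) (s : ℕ) :
    fallingFactorial x (s + 1) = x * fallingFactorial (x - 1) s := by
  rw [fallingFactorial, Finset.prod_range_succ', mul_comm]
  simp [fallingFactorial, sub_sub, add_comm]

/-- The asymptotic rate at which vertices that have latched at least `s` times accumulate, among the
vertices with a label that `b` vertices of the seed other than the hook carry. -/
noncomputable def tailRate (m τ₀ : ℕ) (b : ℝ) (s : ℕ) : ℝ :=
  b * (fallingFactorial m s / fallingFactorial (m * τ₀ - 1) s)

theorem tailRate_zero (m τ₀ : ℕ) (b : ℝ) : tailRate m τ₀ b 0 = b := by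
  simp [tailRate, fallingFactorial]

theorem tailRate_succ (m τ₀ : ℕ) (b : ℝ) (s : ℕ) :
    tailRate m τ₀ b (s + 1) = tailRate m τ₀ b s * (m - s) / (m * τ₀ - 1 - s) := by
  simp only [tailRate, fallingFactorial, Finset.prod_range_succ]
  rw [mul_div_mul_comm]
  ring

theorem tailRate_succ_self (m τ₀ : ℕ) (b : ℝ) : tailRate m τ₀ b (m + 1) = 0 := by
  simp [tailRate_succ]

theorem tailRate_succ' (m τ₀ : ℕ) (b : ℝ) (s : ℕ) : tailRate m τ₀ b (s + 1) =
    fallingFactorial (m - 1) s / fallingFactorial (m * τ₀ - 2) s * (m / (m * τ₀ - 1) * b) := by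
  rw [tailRate, fallingFactorial_succ', fallingFactorial_succ', mul_div_mul_comm,
    sub_sub, one_add_one_eq_two]
  ring

theorem tailRate_sub_tailRate_succ {m τ₀ : ℕ} (hα : 0 ≤ (m : ℝ) * τ₀ - m - 1) (b : ℝ) {s : ℕ}
    (hs : s < m) : tailRate m τ₀ b s - tailRate m τ₀ b (s + 1) =
      (m * τ₀ - m - 1) / (m - s) * tailRate m τ₀ b (s + 1) := by
  have hms : (0 : ℝ) < m - s := sub_pos.2 (by exact_mod_cast hs)
  have hden : (0 : ℝ) < m * τ₀ - 1 - s := by linarith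
  rw [tailRate_succ]
  field_simp
  ring

theorem limitVector_eq_tailRate_sub {m τ₀ : ℕ} (hm : 0 < m) (hα : 0 ≤ (m : ℝ) * τ₀ - m - 1)
    {k : ℕ} (c : Fin k → ℕ) (i : Fin k) (s : Fin (m + 1)) (j : Fin k) :
    limitVector m τ₀ k c i s j = tailRate m τ₀ (c j - if j = i then 1 else 0) s -
      tailRate m τ₀ (c j - if j = i then 1 else 0) (s + 1) := by
  simp only [limitVector, firstBlock]
  generalize (c j : ℝ) - (if j = i then 1 else 0) = b
  split_ifs with hs
  · rw [tailRate_sub_tailRate_succ hα _ hs, tailRate_succ', mul_assoc]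
  · obtain ⟨r, rfl⟩ := Nat.exists_eq_add_one_of_ne_zero hm.ne'
    rw [show (s : ℕ) = r + 1 by omega, tailRate_succ_self, sub_zero, tailRate_succ',
      Nat.add_sub_cancel]

end Limit

section StrongLaw

variable {α β ι : Type*} {G : Graph α β} {hook : α} {m : ℕ} {f : α → ι} {x : ι}
  {q : ℕ → Position α m}

theorem IsAdmissible.tendsto_tailCount_div (hq : IsAdmissible G hook q) (hV : G.vertexSet.Finite)
    (hhook : hook ∈ G.vertexSet)
    (hnoise : ∀ s, Tendsto (fun n : ℕ => (∑ t ∈ Finset.range n,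
      centredIndicator (fun n q => available G hook q n) (colourClass f x s) t q) / n)
      atTop (𝓝 0)) {s : ℕ} (hs : s ≤ m + 1) :
    Tendsto (fun n : ℕ => (tailCount G hook f (latches q) n x s : ℝ) / n) atTop
      (𝓝 (tailRate m G.vertexSet.ncard ({v ∈ G.vertexSet | f v = x} \ {hook}).ncard s)) := by
  have hα := hq.mul_ncard_sub_sub_one_nonneg hV hhook
  have hm : (0 : ℝ) < m := by exact_mod_cast (q 0).2.pos
  induction s with
  | zero =>
    rw [tailRate_zero]
    have h := (tendsto_const_div_atTop_nhds_zero_nat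
      ({v ∈ G.vertexSet | f v = x}.ncard : ℝ)).add_const
      (({v ∈ G.vertexSet | f v = x} \ {hook}).ncard : ℝ)
    rw [zero_add] at h
    refine h.congr' ?_
    filter_upwards [eventually_ne_atTop 0] with n hn
    rw [hq.tailCount_zero hV]
    push_cast
    field_simp
  | succ s ih =>
    have hsm : (s : ℝ) ≤ m := by exact_mod_cast (by omega : s ≤ m)
    have hlim := tendsto_div_of_proportional_outflow (r := m - s) (b := m * G.vertexSet.ncard)
      hα (by linarith) (sub_nonneg.2 hsm) (by linarith [(Nat.cast_nonneg s : (0 : ℝ) ≤ s)])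
      (ih (by omega)) (S := fun n => tailCount G hook f (latches q) n x (s + 1))
      ((hnoise s).congr fun n => ?_)
    · rw [tailRate_succ]
      convert hlim using 3
      ring
    · congr 1
      rw [hq.tailCount_succ_eq_sum hV, ← Finset.sum_sub_distrib]
      refine Finset.sum_congr rfl fun t _ => ?_
      rw [centredIndicator, hq.ncard_colourClass_inter_available hV, hq.ncard_available hV hhook,
        tailCount_eq_labelCount_add hV, Nat.cast_add, add_sub_cancel_right]

theorem ncard_label_sdiff_hook (hV : G.vertexSet.Finite) (hhook : hook ∈ G.vertexSet) {k : ℕ}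
    {d : Fin k → ι} (hd : Function.Injective d) {i : Fin k} (hi : d i = f hook) (j : Fin k) :
    ((({v ∈ G.vertexSet | f v = d j} \ {hook}).ncard : ℕ) : ℝ) =
      {v ∈ G.vertexSet | f v = d j}.ncard - if j = i then 1 else 0 := by
  split_ifs with hj
  · subst hj
    have hmem : hook ∈ {v ∈ G.vertexSet | f v = d j} := ⟨hhook, hi.symm⟩
    rw [eq_sub_iff_add_eq]
    exact_mod_cast Set.ncard_sdiff_singleton_add_one hmem (hV.sep _)
  · have hnot : hook ∉ {v ∈ G.vertexSet | f v = d j} := fun h => hj (hd (h.2.symm.trans hi.symm))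
    rw [Set.sdiff_singleton_eq_self hnot, sub_zero]

theorem IsUniformGrowth.ae_tendsto_labelCount_div {Ω : Type*} [MeasurableSpace Ω] {μ : Measure Ω}
    [IsFiniteMeasure μ] {p : ℕ → Ω → Position α m} (hp : IsUniformGrowth G hook m μ p)
    (hV : G.vertexSet.Finite) (hhook : hook ∈ G.vertexSet) (f : α → ι) (x : ι) :
    ∀ᵐ ω ∂μ, ∀ s ≤ m, Tendsto
      (fun n : ℕ => (labelCount G hook f (latches fun t => p t ω) n x s : ℝ) / n) atTop
      (𝓝 (tailRate m G.vertexSet.ncard ({v ∈ G.vertexSet | f v = x} \ {hook}).ncard s -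
        tailRate m G.vertexSet.ncard ({v ∈ G.vertexSet | f v = x} \ {hook}).ncard (s + 1))) := by
  have hnoise := ae_all_iff.2 fun s => (hp.isUniformSampling hV).ae_tendsto_average_centredIndicator
    (dependsOn_colourClass f x s m)
  filter_upwards [hp.mem_available, hnoise] with ω (hω : IsAdmissible G hook _) hnoiseω s hs
  refine ((hω.tendsto_tailCount_div hV hhook hnoiseω (by omega : s ≤ m + 1)).sub
    (hω.tendsto_tailCount_div hV hhook hnoiseω (by omega : s + 1 ≤ m + 1))).congr fun n => ?_
  rw [← sub_div, tailCount_eq_labelCount_add hV _ _ _ s, Nat.cast_add, add_sub_cancel_right]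

end StrongLaw

end HookingNetwork

theorem theorem1_general {α β ι Ω : Type*} [MeasurableSpace Ω] (μ : Measure Ω) [IsFiniteMeasure μ]
    (G : Graph α β) (hook : α) (hV : G.vertexSet.Finite) (hhook : hook ∈ G.vertexSet) (m : ℕ)
    (f : α → ι) (k : ℕ) (d : Fin k → ι) (hd : Function.Injective d) (i : Fin k)
    (hi : d i = f hook) (p : ℕ → Ω → HookingNetwork.Position α m)
    (hp : HookingNetwork.IsUniformGrowth G hook m μ p) :
    ∀ᵐ ω ∂μ, Tendsto
      (fun n : ℕ => fun (s : Fin (m + 1)) (j : Fin k) =>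
        (HookingNetwork.labelCount G hook f (HookingNetwork.latches fun t => p t ω) n (d j) s : ℝ) /
          n)
      atTop
      (𝓝 (HookingNetwork.limitVector m G.vertexSet.ncard k
        (fun j => {v ∈ G.vertexSet | f v = d j}.ncard) i)) := by
  have hlim := ae_all_iff.2 fun j => hp.ae_tendsto_labelCount_div hV hhook f (d j)
  filter_upwards [hp.mem_available, hlim] with ω (hω : HookingNetwork.IsAdmissible G hook _) hlimω
  refine tendsto_pi_nhds.2 fun s => tendsto_pi_nhds.2 fun j => ?_
  have hα := hω.mul_ncard_sub_sub_one_nonneg hV hhook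
  rw [HookingNetwork.limitVector_eq_tailRate_sub (p 0 ω).2.pos hα,
    ← HookingNetwork.ncard_label_sdiff_hook hV hhook hd hi j]
  exact hlimω j s (by omega)

theorem theorem1 {α β Ω : Type*} [MeasurableSpace Ω] (μ : Measure Ω) [IsProbabilityMeasure μ]
    (G : Graph α β) (hook : α) (hG : HookingNetwork.IsSeed G hook)
    (m : ℕ) (hm : 1 ≤ m)
    (k : ℕ) (d : Fin k → ℕ) (hd : StrictMono d)
    (hrange : Set.range d = HookingNetwork.deg G '' G.vertexSet)
    (i : Fin k) (hi : d i = HookingNetwork.deg G hook)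
    (hinv : IsUnit
      (HookingNetwork.replacementMatrix m k (fun j => HookingNetwork.seedCount G (d j)) i).transpose)
    (p : ℕ → Ω → HookingNetwork.Position α m)
    (hp : HookingNetwork.IsUniformGrowth G hook m μ p) :
    ∀ᵐ ω ∂μ, Tendsto
      (fun n : ℕ => fun (s : Fin (m + 1)) (j : Fin k) =>
        (HookingNetwork.degreeCount G hook (HookingNetwork.latches fun t => p t ω) n (d j) s : ℝ)
          / (n : ℝ))
      atTop
      (𝓝 (HookingNetwork.limitVector m G.vertexSet.ncard k
        (fun j => HookingNetwork.seedCount G (d j)) i)) :=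
  theorem1_general μ G hook hG.finite_vertexSet hG.hook_mem m (HookingNetwork.deg G) k d
    hd.injective i hi p hp
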